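/- Conventions. Names are elements of Baire space $\mathbb{N}^{\mathbb{N}}$; $\langle p,q\rangle$ is a standard pairing on $\mathbb{N}^{\mathbb N}$, $\langle p^{(0)},p^{(1)},\dots\rangle$ denotes the $s$ with $s_{\langle j,k\rangle}=p^{(j)}_k$, and $a.p$ is $p$ with the symbol $a$ put in front. $\eta$ is a standard representation of the continuous partial functions $\subseteq\mathbb{N}^{\mathbb N}\to\mathbb{N}^{\mathbb N}$ with $\Pi^0_2$ domain, and a partial function is computable iff it is $\eta_p$ for a computable $p$. A realizer of a (multi-valued) operation $f$ is a partial function mapping each name of each $x\in\operatorname{dom} f$ to a name of some element of $f(x)$; $f$ is computable if it has a computable realizer. $\nu_{\mathbb Q},\nu_{\mathbb Q^+}$ are standard total numberings of $\mathbb{Q}$ and of the positive rationals. Let $(X,d,\nu)$ be a computable metric space: $(X,d)$ is a metric space, $\nu:\mathbb{N}\to X$ is a dense sequence and the double sequence of reals $d(\nu(i),\nu(j))$ is computable. A Cauchy name of $x\in X$ is a $p$ with $d(\nu(p_i),\nu(p_j))<2^{-\min\{i,j\}}$ for all $i,j$ and $\lim_i\nu(p_i)=x$. Put $\alpha\langle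 a,r\rangle=B(\nu(a);\nu_{\mathbb{Q}^+}(r))$ (open ball), $\alpha'(0)=\emptyset$, $\alpha'(n+1)=\alpha(n)$. A name of an open set $U$ is a $p$ with $U=\bigcup\{\alpha(p_i-1): p_i\ge 1\}$. Names of closed sets $A\subseteq X$. A $\delta_{\mathrm{range}}$-name of $A\neq\emptyset$ is some $\langle p^{(0)},p^{(1)},\dots\rangle$ such that all entries are $\geq 1$ and, after subtracting $1$ from all entries, the $p^{(i)}$ are Cauchy names of points of $A$ which are dense in $A$; the name of $\emptyset$ is constantly $0$. A $\delta_{\mathrm{dist}}^{>}$-name of $A$ is a $p$ such that $\eta_p$ maps every Cauchy name of every $x\in X$ to some $r$ with $\{r_i-1: r_i\geq 1\}=\{n:\nu_{\mathbb Q}(n)<d_A(x)\}$, where $d_A(x)=\inf_{a\in A}d(x,a)\in[0,\infty]$. A $\delta_{\mathrm{range}}\sqcap\delta_{\mathrm{dist}}^{>}$-name of $A$ is a pair $\langle p,q\rangle$ of a $\delta_{\mathrm{range}}$-name and a $\delta_{\mathrm{dist}}^{>}$-name of $A$. Dugundji systems. For $A\subseteq X$ closed and nonempty and $\epsilon\in(0,\infty)$,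 a pair $((V_i)_{i\in\mathbb N},(y_i)_{i\in\mathbb N})$ of a sequence of open subsets and a sequence of points of $X$ is a Dugundji system for $A$ with coefficient $1+\epsilon$ if (0) $(V_i)_i$ is locally finite in its union: every point of $\bigcup_i V_i$ lies in some $\alpha'(a)$ which meets $V_j$ for only finitely many $j$; (1) $\bigcup_i V_i=X\setminus A$ and $y_i\in A$ for all $i$; (2) $d(x,y_i)\le(1+\epsilon)\,d_A(x)$ for all $i$ and all $x\in V_i$; (3) if $(n_i)_i\subseteq\mathbb{N}$ has $\lim_{i}d(V_{n_i},A)=0$, then $\lim_{i}\operatorname{diam}V_{n_i}=0$ (where $d(\emptyset,A)=\infty$, $\operatorname{diam}\emptyset=0$). Let $\mathcal{D}(X)$ be the set of all pairs which are a Dugundji system with coefficient $2$ for some nonempty closed $A$ (namely $A=X\setminus\bigcup_iV_i$). A $\delta_3$-name of $((V_i)_i,(y_i)_i)\in\mathcal{D}(X)$ is some $\langle\langle p,q,r\rangle,s\rangle$ such that $p=\langle p^{(0)},\dots\rangle$ with $p^{(i)}$ a name of the open set $V_i$; $\bigcup_jV_j=\bigcup_i\alpha'(q_i)$; for each $i$,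 every $j$ with $V_j\cap\alpha'(q_i)\ne\emptyset$ belongs to the finite set $F_i$ with $r_i=\sum_{k\in F_i}2^k$; and $s=\langle s^{(0)},\dots\rangle$ with $s^{(i)}$ a Cauchy name of $y_i$. Proposition. In every computable metric space $(X,d,\nu)$, the multi-valued operation $Q:\subseteq\mathbb{Q}\times\{A\subseteq X: A\text{ closed}\}\rightrightarrows\mathcal{D}(X)$ with domain $\{(\epsilon,A):\epsilon>0,\ \emptyset\neq A\neq X\}$, $$Q(\epsilon,A)=\{D\in\mathcal{D}(X): D\text{ is a Dugundji system for }A\text{ with coefficient }1+\epsilon\},$$ is $(\nu_{\mathbb Q},\delta_{\mathrm{range}}\sqcap\delta_{\mathrm{dist}}^{>};\delta_3)$-computable. That is, there is a computable $F:\subseteq\mathbb{N}^{\mathbb N}\to\mathbb{N}^{\mathbb N}$ such that whenever $\nu_{\mathbb Q}(a)=\epsilon>0$ and $p$ is a $\delta_{\mathrm{range}}\sqcap\delta_{\mathrm{dist}}^{>}$-name of a closed set $A$ with $\emptyset\ne A\ne X$, then $F(a.p)$ is defined and is a $\delta_3$-name of some element of $Q(\epsilon,A)$. -/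

import Mathlib

open Set Filter Topology TopologicalSpace

noncomputable section

namespace TTE

/-! ### Baire space, pairing, and the standard representation of continuous partial functions -/

/-- Baire space `ℕ^ℕ`, whose elements serve as names. -/
abbrev Baire : Type := ℕ → ℕ

/-- First component of `⟨p, q⟩`, where `⟨p, q⟩` is the interleaving of `p` and `q`. -/
def fstName (s : Baire) : Baire := fun n => s (2 * n)

/-- Second component of `⟨p, q⟩`. -/
def sndName (s : Baire) : Baire := fun n => s (2 * n + 1)

/-- The component `p⁽ʲ⁾` of `⟨p⁽⁰⁾, p⁽¹⁾, …⟩`, where `⟨p⁽⁰⁾, …⟩_⟨j,k⟩ = p⁽ʲ⁾_k`. -/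
def compName (s : Baire) (j : ℕ) : Baire := fun k => s (Nat.pair j k)

/-- The answer that `p`, read as a table on finite words, gives about the `n`-th output symbol
when the prefix `q 0, …, q (k - 1)` of the input is known: `0` means that the prefix is not yet
sufficient, and `m + 1` means that the output symbol is `m`. -/
def answer (p q : Baire) (n k : ℕ) : ℕ :=
  p (Nat.pair n (Encodable.encode ((List.range k).map q)))

/-- The standard representation `η` of the continuous partial functions on Baire space with `Π⁰₂`
domain: `η_p(q)_n` is the first nonzero answer of `p` along the prefixes of `q`, minus `1`, and
`η_p(q)` is defined iff all output symbols are. (This is Kleene's application of `p` to `q`.) -/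
def eta (p : Baire) : Baire →. Baire := fun q =>
  ⟨∀ n, ∃ k, answer p q n k ≠ 0, fun h n => answer p q n (Nat.find (h n)) - 1⟩

/-- Computable partial functions on Baire space: those given by a computable table, that is, a
computable function tells from `n` and a finite input prefix either the `n`-th output symbol, or
that the prefix does not suffice (within the number of steps given by its length). -/
def IsComputableFun (F : Baire →. Baire) : Prop :=
  ∃ p : Baire, Computable p ∧ F = eta p

/-! ### Representations and computable operations -/

/-- A representation `δ : ⊆ ℕ^ℕ → α`, given through its graph: `δ p x` means `p ∈ δ⁻¹{x}`. -/
abbrev Rep (α : Type*) := Baire → α → Prop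

/-- `F` is a `(δ, δ')`-realizer of the total function `f`. -/
def Realizes {α β : Type*} (δ : Rep α) (δ' : Rep β) (F : Baire →. Baire) (f : α → β) : Prop :=
  ∀ p x, δ p x → ∃ q, q ∈ F p ∧ δ' q (f x)

/-- The multi-valued operation `f` with domain `D` is `(δ; δ')`-computable: some computable
`F : ⊆ ℕ^ℕ → ℕ^ℕ` maps each name of each `x ∈ D` to a name of some element of `f x`. -/
def OpComputable {α β : Type*} (δ : Rep α) (δ' : Rep β) (D : Set α) (f : α → Set β) : Prop :=
  ∃ F : Baire →. Baire, IsComputableFun F ∧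
    ∀ p, ∀ x ∈ D, δ p x → ∃ q, q ∈ F p ∧ ∃ y ∈ f x, δ' q y

/-- The greatest lower bound `δ ⊓ δ'`: names are pairs `⟨p, q⟩` of a `δ`-name and a `δ'`-name. -/
def meetRep {α : Type*} (δ δ' : Rep α) : Rep α := fun s x => δ (fstName s) x ∧ δ' (sndName s) x

/-- The countable power `δ^ω`. -/
def powRep {α : Type*} (δ : Rep α) : Rep (ℕ → α) := fun s x => ∀ i, δ (compName s i) (x i)

/-- For a numbering `ν` and a representation `δ`: names of pairs have the form `a.p`, where `a` is
a `ν`-index of the first component and `p` a `δ`-name of the second. -/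
def numProdRep {α β : Type*} (ν : ℕ → α) (δ : Rep β) : Rep (α × β) := fun s x =>
  ν (s 0) = x.1 ∧ δ (fun n => s (n + 1)) x.2

/-- Standard total numbering of the rationals, `⟨i, ⟨j, k⟩⟩ ↦ (i - j) / (k + 1)`. -/
def nuQ (n : ℕ) : ℚ :=
  ((n.unpair.1 : ℚ) - (n.unpair.2.unpair.1 : ℚ)) / ((n.unpair.2.unpair.2 : ℚ) + 1)

/-- Standard total numbering of the positive rationals, `⟨i, j⟩ ↦ (i + 1) / (j + 1)`. -/
def nuQPos (n : ℕ) : ℚ := ((n.unpair.1 : ℚ) + 1) / ((n.unpair.2 : ℚ) + 1)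

/-- `ρ_<` extended to `[-∞, ∞]`: a name of `t` enumerates the set of all indices of rationals
below `t` (the symbol `0` is padding). -/
def lowerRep : Rep EReal := fun p t =>
  {n : ℕ | (((nuQ n : ℚ) : ℝ) : EReal) < t} = {n : ℕ | ∃ i, 1 ≤ p i ∧ n = p i - 1}

/-! ### Computable metric spaces and their hyperspaces -/

section Metric

variable {X : Type*} [MetricSpace X]

/-- `(X, d, ν)` is a computable metric space: `ν` is a dense sequence, and the double sequence of
reals `d (ν i) (ν j)` is computable. -/
structure IsComputableMetricSpace (ν : ℕ → X) : Prop where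
  dense : DenseRange ν
  dist_computable : ∃ g : ℕ × ℕ × ℕ → ℕ, Computable g ∧
    ∀ i j k, |dist (ν i) (ν j) - (nuQ (g (i, j, k)) : ℝ)| < 2⁻¹ ^ k

/-- The Cauchy representation of `X`. -/
def cauchyRep (ν : ℕ → X) : Rep X := fun p x =>
  (∀ i j, dist (ν (p i)) (ν (p j)) < 2⁻¹ ^ min i j) ∧
    Tendsto (fun i => ν (p i)) atTop (𝓝 x)

/-- The standard ball numbering `α⟨a, r⟩ = B(ν(a); ν_{ℚ⁺}(r))`. -/
def ballNum (ν : ℕ → X) (n : ℕ) : Set X :=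
  Metric.ball (ν n.unpair.1) (nuQPos n.unpair.2 : ℝ)

/-- The shift `α'` of the ball numbering: `α'(0) = ∅`, `α'(n + 1) = α(n)`. -/
def ballNum' (ν : ℕ → X) : ℕ → Set X
  | 0 => ∅
  | n + 1 => ballNum ν n

/-- The representation `δ_{Σ⁰₁(X)}` of open sets: names enumerate ideal balls with union `U`. -/
def openRep (ν : ℕ → X) : Rep (Opens X) := fun p U =>
  (U : Set X) = ⋃ i ∈ {i : ℕ | 1 ≤ p i}, ballNum ν (p i - 1)

/-- The representation `δ_range` of closed sets. A name of `A ≠ ∅` lists names (with all symbols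
increased by `1`) of the points of a sequence dense in `A`; the name of `∅` is constantly `0`. -/
def rangeRep (ν : ℕ → X) : Rep (Closeds X) := fun s A =>
  ((A : Set X) = ∅ ∧ ∀ i k, compName s i k = 0) ∨
  ((A : Set X).Nonempty ∧
    (∀ i, (∀ k, 1 ≤ compName s i k) ∧
      ∃ z ∈ (A : Set X), cauchyRep ν (fun k => compName s i k - 1) z) ∧
    ∀ x ∈ (A : Set X), ∀ U : Set X, IsOpen U → x ∈ U →
      ∃ i, ∃ z ∈ U, cauchyRep ν (fun k => compName s i k - 1) z)

/-- The distance function `d_A : X → [-∞, ∞]`, with `d_∅ = ∞`. -/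
def distFun (A : Closeds X) (x : X) : EReal := ((Metric.infEDist x (A : Set X) : ENNReal) : EReal)

/-- The representation `δ_dist^>` of closed sets: `p` is a name of `A` iff `η_p` realizes `d_A`
with respect to the Cauchy representation and lower reals. -/
def distRep (ν : ℕ → X) : Rep (Closeds X) := fun p A =>
  Realizes (cauchyRep ν) lowerRep (eta p) (distFun A)

/-! ### Local finiteness and Dugundji systems -/

/-- The class `LF` of sequences of open sets which are locally finite in their union. -/
def IsLF (ν : ℕ → X) (V : ℕ → Opens X) : Prop :=
  ∀ x, ∀ i, x ∈ V i → ∃ a : ℕ, ∃ S : Finset ℕ,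
    x ∈ ballNum' ν a ∧ {j | ((V j : Set X) ∩ ballNum' ν a).Nonempty} ⊆ (S : Set ℕ)

/-- The finite set of natural numbers with index `k`, where `F` has index `∑ i ∈ F, 2 ^ i`. -/
def finIdx (k : ℕ) : Set ℕ := {i | k.testBit i = true}

/-- The representation `δ₁`, names `⟨p, ⟨q, r⟩⟩`: `p` names the sequence of sets, `q` lists balls
covering their union, and `r i` is the index of a finite set containing every `j` such that `V j`
meets the `i`-th ball. -/
def lfRep₁ (ν : ℕ → X) : Rep (ℕ → Opens X) := fun s V =>
  IsLF ν V ∧ powRep (openRep ν) (fstName s) V ∧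
  (⋃ j, (V j : Set X)) ⊆ ⋃ i, ballNum' ν (fstName (sndName s) i) ∧
  ∀ i, {j | ((V j : Set X) ∩ ballNum' ν (fstName (sndName s) i)).Nonempty} ⊆
    finIdx (sndName (sndName s) i)

/-- The representation `δ₂`: as `δ₁`, but the balls listed by `q` have exactly the union of the
sets `V j` as their union. -/
def lfRep₂ (ν : ℕ → X) : Rep (ℕ → Opens X) := fun s V =>
  lfRep₁ ν s V ∧ (⋃ j, (V j : Set X)) = ⋃ i, ballNum' ν (fstName (sndName s) i)

/-- The distance `d(V, A) ∈ [0, ∞]` between two sets (`∞` if one of them is empty). -/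
def setEDist (V A : Set X) : ENNReal := ⨅ x ∈ V, Metric.infEDist x A

/-- `(V, y)` is a Dugundji system for the nonempty closed set `A` with coefficient `1 + ε`. -/
structure IsDugundji (ν : ℕ → X) (ε : ℝ) (A : Closeds X) (V : ℕ → Opens X) (y : ℕ → X) :
    Prop where
  eps_pos : 0 < ε
  nonempty : (A : Set X).Nonempty
  locallyFinite : IsLF ν V
  iUnion_eq : (⋃ i, (V i : Set X)) = (A : Set X)ᶜ
  mem : ∀ i, y i ∈ A
  dist_le : ∀ i, ∀ x ∈ V i, dist x (y i) ≤ (1 + ε) * Metric.infDist x (A : Set X)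
  diam_tendsto : ∀ n : ℕ → ℕ,
    Tendsto (fun i => setEDist (V (n i) : Set X) (A : Set X)) atTop (𝓝 0) →
      Tendsto (fun i => Metric.ediam (V (n i) : Set X)) atTop (𝓝 0)

/-- The space `𝒟(X)` of Dugundji systems; when no coefficient is given, it is `2`. -/
def DugundjiSpace (ν : ℕ → X) : Type _ :=
  {D : (ℕ → Opens X) × (ℕ → X) // ∃ A : Closeds X, IsDugundji ν 1 A D.1 D.2}

/-- The representation `δ₃` of `𝒟(X)`: a `δ₂`-name of the cover and a name of the points. -/
def dugundjiRep (ν : ℕ → X) : Rep (DugundjiSpace ν) := fun s D =>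
  lfRep₂ ν (fstName s) D.1.1 ∧ powRep (cauchyRep ν) (sndName s) D.1.2

/-- The values of the operation `Q : ⊆ ℚ × 𝒜(X) ⇉ 𝒟(X)`: the elements of `𝒟(X)` which are
Dugundji systems for `A` with coefficient `1 + ε`. -/
def opQ (ν : ℕ → X) (x : ℚ × Closeds X) : Set (DugundjiSpace ν) :=
  {D | IsDugundji ν (x.1 : ℝ) x.2 D.1.1 D.1.2}

/-- The domain of `Q`: pairs `(ε, A)` with `ε > 0` and `∅ ≠ A ≠ X`. -/
def domQ : Set (ℚ × Closeds X) :=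
  {x | 0 < x.1 ∧ (x.2 : Set X) ≠ ∅ ∧ (x.2 : Set X) ≠ Set.univ}

end Metric

end TTE

end

/-!
An ideal ball `B` is attached to a point `y ∈ A` when `B` is small compared with its distance from
`A` and `y` is almost a nearest point of `A` for every point of `B`. Both conditions are implied by
a strict inequality between a lower bound of the distance of the center from `A` and an
approximation of its distance from `y`, so the pairs for which such an inequality has been found
can be enumerated; the balls of half the radius cover `X \ A`. Let `V i` be the `i`-th ball without
the closed half balls with smaller index. The least closed half ball containing a given point keeps
the point, so the `V i` still cover `X \ A`. Since `V j` misses the `i`-th half ball for `i < j`,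
the half balls are neighbourhoods witnessing local finiteness, with the finite sets `{0, …, i}`.
-/

noncomputable section

namespace TTE

/-! ### Computable functionals of a name -/

section Functionals

variable {α β γ : Type*}

/-- The word of the first `k` symbols of a name. -/
def prefixWord (s : Baire) (k : ℕ) : List ℕ := (List.range k).map s

/-- A stagewise computation with value `b`: each stage has no output or outputs `b`, and all
sufficiently late stages do output `b`. -/
def ConvergesTo (o : ℕ → Option β) (b : β) : Prop :=
  (∀ k, o k = none ∨ o k = some b) ∧ ∀ᶠ k in atTop, o k = some b

theorem convergesTo_const (b : β) : ConvergesTo (fun _ => some b) b :=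
  ⟨fun _ => Or.inr rfl, .of_forall fun _ => rfl⟩

theorem ConvergesTo.bind {o : ℕ → Option β} {b : β} {f : ℕ → β → Option γ} {c : γ}
    (ho : ConvergesTo o b) (hf : ConvergesTo (fun k => f k b) c) :
    ConvergesTo (fun k => (o k).bind (f k)) c := by
  refine ⟨fun k => ?_, ?_⟩
  · rcases ho.1 k with h | h
    · exact Or.inl (by simp only [h, Option.bind_none])
    · simpa only [h, Option.bind_some] using hf.1 k
  · filter_upwards [ho.2, hf.2] with k h h'
    rw [h, Option.bind_some, h']

variable [Primcodable α] [Primcodable β]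

/-- Computability of a total functional `Φ` whose arguments are a name, serving as oracle, and an
element of a countable type: `Φ s a` is computed in stages, the `k`-th of which sees the first `k`
symbols of `s`. -/
def ComputableFunctional (Φ : Baire → α → β) : Prop :=
  ∃ φ : List ℕ → α → Option β, Computable₂ φ ∧
    ∀ s a, ConvergesTo (fun k => φ (prefixWord s k) a) (Φ s a)

/-- Decidability of a property of a name and of an element of a countable type, relative to the
name. -/
def ComputablePredicate (P : Baire → α → Prop) : Prop :=
  ∃ χ : Baire → α → Bool, ComputableFunctional χ ∧ ∀ s a, χ s a = true ↔ P s a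

end Functionals

namespace ComputableFunctional

variable {α β γ δ : Type*} [Primcodable α] [Primcodable β] [Primcodable γ] [Primcodable δ]

theorem of_computable {f : α → β} (hf : Computable f) : ComputableFunctional fun _ => f :=
  ⟨fun _ a => some (f a), Computable.option_some.comp (hf.comp Computable.snd),
    fun _ a => convergesTo_const (f a)⟩

theorem comp {Φ : Baire → β → γ} {Ψ : Baire → α → β} (hΦ : ComputableFunctional Φ)
    (hΨ : ComputableFunctional Ψ) : ComputableFunctional fun s a => Φ s (Ψ s a) := by
  obtain ⟨φ, hφ, hφΦ⟩ := hΦ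
  obtain ⟨ψ, hψ, hψΨ⟩ := hΨ
  exact ⟨fun w a => (ψ w a).bind (φ w),
    Computable.option_bind hψ (hφ.comp (Computable.fst.comp Computable.fst) Computable.snd),
    fun s a => (hψΨ s a).bind (hφΦ s _)⟩

theorem pair {Φ : Baire → α → β} {Ψ : Baire → α → γ} (hΦ : ComputableFunctional Φ)
    (hΨ : ComputableFunctional Ψ) : ComputableFunctional fun s a => (Φ s a, Ψ s a) := by
  obtain ⟨φ, hφ, hφΦ⟩ := hΦ
  obtain ⟨ψ, hψ, hψΨ⟩ := hΨ
  refine ⟨fun w a => (φ w a).bind fun b => (ψ w a).bind fun c => some (b, c), ?_,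
    fun s a => (hφΦ s a).bind ((hψΨ s a).bind (convergesTo_const _))⟩
  have hψ' : Computable fun x : (List ℕ × α) × β => ψ x.1.1 x.1.2 := hψ.comp
    (Computable.fst.comp Computable.fst) (Computable.snd.comp Computable.fst)
  exact Computable.option_bind hφ (Computable.option_bind hψ'
    (Computable.option_some.comp ((Computable.snd.comp Computable.fst).pair Computable.snd)))

theorem map {f : β → γ} (hf : Computable f) {Φ : Baire → α → β} (hΦ : ComputableFunctional Φ) :
    ComputableFunctional fun s a => f (Φ s a) :=
  (of_computable hf).comp hΦ

theorem map₂ {f : β → γ → δ} (hf : Computable₂ f) {Φ : Baire → α → β} {Ψ : Baire → α → γ}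
    (hΦ : ComputableFunctional Φ) (hΨ : ComputableFunctional Ψ) :
    ComputableFunctional fun s a => f (Φ s a) (Ψ s a) :=
  (of_computable hf).comp (hΦ.pair hΨ)

theorem const (b : β) : ComputableFunctional fun (_ : Baire) (_ : α) => b :=
  of_computable (Computable.const b)

theorem apply {f : Baire → α → ℕ} (hf : ComputableFunctional f) :
    ComputableFunctional fun s a => s (f s a) := by
  refine comp (Φ := fun s n => s n) ⟨fun w n => w[n]?, Computable.list_getElem?, fun s n => ?_⟩ hf
  have entry : ∀ k, (prefixWord s k)[n]? = if n < k then some (s n) else none := fun k => by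
    by_cases h : n < k <;> simp [prefixWord, h]
  refine ⟨fun k => ?_, ?_⟩
  · by_cases h : n < k <;> simp [entry, h]
  · filter_upwards [eventually_gt_atTop n] with k h
    rw [entry, if_pos h]

theorem nat_rec {base : Baire → α → β} {step : Baire → α × ℕ × β → β}
    (hbase : ComputableFunctional base) (hstep : ComputableFunctional step) :
    ComputableFunctional fun s (x : α × ℕ) =>
      (Nat.rec (base s x.1) (fun k b => step s (x.1, k, b)) x.2 : β) := by
  obtain ⟨φ, hφ, hφbase⟩ := hbase
  obtain ⟨ψ, hψ, hψstep⟩ := hstep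
  refine ⟨fun w x => Nat.rec (φ w x.1) (fun k o => o.bind fun b => ψ w (x.1, k, b)) x.2,
    ?_, fun s ⟨a, n⟩ => ?_⟩
  · have hw : Computable fun x : ((List ℕ × α × ℕ) × ℕ × Option β) × β => x.1.1 :=
      Computable.fst.comp Computable.fst
    have hψ' : Computable₂ fun (x : List ℕ × α × ℕ) (y : ℕ × Option β) =>
        y.2.bind fun b => ψ x.1 (x.2.1, y.1, b) :=
      Computable.option_bind (Computable.snd.comp Computable.snd) (hψ.comp
        (Computable.fst.comp hw) ((Computable.fst.comp (Computable.snd.comp hw)).pair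
          ((Computable.fst.comp (Computable.snd.comp Computable.fst)).pair Computable.snd)))
    have hφ' : Computable fun x : List ℕ × α × ℕ => φ x.1 x.2.1 :=
      hφ.comp Computable.fst (Computable.fst.comp Computable.snd)
    exact Computable.nat_rec (Computable.snd.comp Computable.snd) hφ' hψ'
  · induction n with
    | zero => exact hφbase s a
    | succ n ih => exact ih.bind (hψstep s _)

theorem exists_isComputableFun {Φ : Baire → Baire} (hΦ : ComputableFunctional Φ) :
    ∃ F : Baire →. Baire, IsComputableFun F ∧ ∀ s, Φ s ∈ F s := by
  obtain ⟨φ, hφ, hφΦ⟩ := hΦ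
  let table : Baire := fun m =>
    ((φ (Denumerable.ofNat (List ℕ) m.unpair.2) m.unpair.1).map Nat.succ).getD 0
  have table_computable : Computable table :=
    Computable.option_getD (Computable.option_map (hφ.comp
      ((Computable.ofNat _).comp (Computable.snd.comp Computable.unpair))
      (Computable.fst.comp Computable.unpair)) (Computable.succ.comp Computable.snd))
      (Computable.const 0)
  have answer_table : ∀ s n k,
      answer table s n k = ((φ (prefixWord s k) n).map Nat.succ).getD 0 := fun s n k => by
    simp only [answer, table, Nat.unpair_pair, Denumerable.ofNat_encode, prefixWord]
  refine ⟨eta table, ⟨table, table_computable, rfl⟩, fun s => ?_⟩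
  have defined : ∀ n, ∃ k, answer table s n k ≠ 0 := fun n => by
    obtain ⟨k, hk⟩ := (hφΦ s n).2.exists
    exact ⟨k, by simp [answer_table, hk]⟩
  refine ⟨defined, funext fun n => ?_⟩
  have found := Nat.find_spec (defined n)
  change answer table s n (Nat.find (defined n)) - 1 = Φ s n
  rw [answer_table] at found ⊢
  rcases (hφΦ s n).1 (Nat.find (defined n)) with h | h <;> simp [h] at found ⊢

variable {f g : Baire → α → ℕ}

theorem add (hf : ComputableFunctional f) (hg : ComputableFunctional g) :
    ComputableFunctional fun s a => f s a + g s a :=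
  map₂ Primrec.nat_add.to_comp hf hg

theorem sub (hf : ComputableFunctional f) (hg : ComputableFunctional g) :
    ComputableFunctional fun s a => f s a - g s a :=
  map₂ Primrec.nat_sub.to_comp hf hg

theorem mul (hf : ComputableFunctional f) (hg : ComputableFunctional g) :
    ComputableFunctional fun s a => f s a * g s a :=
  map₂ Primrec.nat_mul.to_comp hf hg

theorem natPair (hf : ComputableFunctional f) (hg : ComputableFunctional g) :
    ComputableFunctional fun s a => Nat.pair (f s a) (g s a) :=
  map₂ Primrec₂.natPair.to_comp hf hg

theorem eq (hf : ComputableFunctional f) (hg : ComputableFunctional g) :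
    ComputablePredicate fun s a => f s a = g s a :=
  ⟨_, map₂ Primrec.eq.decide.to_comp hf hg, fun _ _ => decide_eq_true_iff⟩

theorem le (hf : ComputableFunctional f) (hg : ComputableFunctional g) :
    ComputablePredicate fun s a => f s a ≤ g s a :=
  ⟨_, map₂ Primrec.nat_le.decide.to_comp hf hg, fun _ _ => decide_eq_true_iff⟩

theorem ite {P : Baire → α → Prop} [∀ s a, Decidable (P s a)] {Φ Ψ : Baire → α → β}
    (hP : ComputablePredicate P) (hΦ : ComputableFunctional Φ) (hΨ : ComputableFunctional Ψ) :
    ComputableFunctional fun s a => if P s a then Φ s a else Ψ s a := by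
  obtain ⟨χ, hχ, hχP⟩ := hP
  have select : Computable fun x : Bool × β × β => bif x.1 then x.2.1 else x.2.2 :=
    Computable.cond Computable.fst (Computable.fst.comp Computable.snd)
      (Computable.snd.comp Computable.snd)
  simpa only [Bool.cond_eq_ite, hχP] using map select (hχ.pair (hΦ.pair hΨ))

end ComputableFunctional

namespace ComputablePredicate

variable {α β : Type*} [Primcodable α] [Primcodable β] {P Q : Baire → α → Prop}

theorem comp {P : Baire → β → Prop} (hP : ComputablePredicate P) {Φ : Baire → α → β}
    (hΦ : ComputableFunctional Φ) : ComputablePredicate fun s a => P s (Φ s a) := by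
  obtain ⟨χ, hχ, hχP⟩ := hP
  exact ⟨_, hχ.comp hΦ, fun s a => hχP s _⟩

theorem and (hP : ComputablePredicate P) (hQ : ComputablePredicate Q) :
    ComputablePredicate fun s a => P s a ∧ Q s a := by
  obtain ⟨χ, hχ, hχP⟩ := hP
  obtain ⟨ψ, hψ, hψQ⟩ := hQ
  exact ⟨_, .map₂ Primrec.and.to_comp hχ hψ, fun s a => by rw [Bool.and_eq_true, hχP, hψQ]⟩

theorem imp (hP : ComputablePredicate P) (hQ : ComputablePredicate Q) :
    ComputablePredicate fun s a => P s a → Q s a := by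
  obtain ⟨χ, hχ, hχP⟩ := hP
  obtain ⟨ψ, hψ, hψQ⟩ := hQ
  refine ⟨_, .map₂ Primrec.or.to_comp (.map Primrec.not.to_comp hχ) hψ, fun s a => ?_⟩
  change _ ↔ (P s a → Q s a)
  rw [Bool.or_eq_true, Bool.not_eq_true', ← Bool.not_eq_true, hχP, hψQ, imp_iff_not_or]

theorem forall_lt {P : Baire → α → ℕ → Prop}
    (hP : ComputablePredicate fun s (x : α × ℕ) => P s x.1 x.2) {n : Baire → α → ℕ}
    (hn : ComputableFunctional n) : ComputablePredicate fun s a => ∀ k < n s a, P s a k := by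
  obtain ⟨χ, hχ, hχP⟩ := hP
  let allBelow (s : Baire) (x : α × ℕ) : Bool := Nat.rec true (fun k b => χ s (x.1, k) && b) x.2
  have allBelow_computable : ComputableFunctional allBelow :=
    .nat_rec (step := fun s x => χ s (x.1, x.2.1) && x.2.2) (.const true)
      (.map₂ Primrec.and.to_comp
        (hχ.comp (.of_computable (Computable.fst.pair (Computable.fst.comp Computable.snd))))
        (.of_computable (Computable.snd.comp Computable.snd)))
  have allBelow_iff : ∀ s a m, allBelow s (a, m) = true ↔ ∀ k < m, P s a k := fun s a m => by
    induction m with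
    | zero => simp [allBelow]
    | succ m ih =>
      change (χ s (a, m) && allBelow s (a, m)) = true ↔ _
      rw [Bool.and_eq_true, ih, hχP, Nat.forall_lt_succ_right, and_comm]
  exact ⟨_, allBelow_computable.comp ((ComputableFunctional.of_computable .id).pair hn),
    fun s a => allBelow_iff s a (n s a)⟩

end ComputablePredicate

/-! ### Assembling names -/

/-- The name `⟨p, q⟩`. -/
def pairName (p q : Baire) : Baire := fun n => if n % 2 = 0 then p (n / 2) else q (n / 2)

/-- The name `⟨p 0, p 1, …⟩`. -/
def tupleName (p : ℕ → Baire) : Baire := fun n => p n.unpair.1 n.unpair.2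

@[simp]
theorem fstName_pairName (p q : Baire) : fstName (pairName p q) = p := by
  funext n
  simp [fstName, pairName]

@[simp]
theorem sndName_pairName (p q : Baire) : sndName (pairName p q) = q := by
  funext n
  have odd : (2 * n + 1) % 2 ≠ 0 := by omega
  have half : (2 * n + 1) / 2 = n := by omega
  simp only [sndName, pairName, if_neg odd, half]

@[simp]
theorem compName_tupleName (p : ℕ → Baire) (i : ℕ) : compName (tupleName p) i = p i := by
  funext k
  simp [compName, tupleName]

namespace ComputableFunctional

theorem pairName {Φ Ψ : Baire → Baire} (hΦ : ComputableFunctional Φ)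
    (hΨ : ComputableFunctional Ψ) : ComputableFunctional fun s => pairName (Φ s) (Ψ s) := by
  have half : ComputableFunctional fun (_ : Baire) (n : ℕ) => n / 2 :=
    of_computable (Primrec.nat_div.to_comp.comp .id (.const 2))
  have mod : ComputableFunctional fun (_ : Baire) (n : ℕ) => n % 2 :=
    of_computable (Primrec.nat_mod.to_comp.comp .id (.const 2))
  exact ite (mod.eq (const 0)) (hΦ.comp half) (hΨ.comp half)

theorem tupleName {Φ : Baire → ℕ → Baire}
    (hΦ : ComputableFunctional fun s (x : ℕ × ℕ) => Φ s x.1 x.2) :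
    ComputableFunctional fun s => tupleName (Φ s) :=
  hΦ.comp (of_computable Computable.unpair)

end ComputableFunctional

/-! ### Dugundji systems from Whitney families -/

section Whitney

variable {X : Type*} [PseudoMetricSpace X] {I : Set ℕ} {c : ℕ → X} {r : ℕ → ℝ} {i : ℕ} {x : X}

/-- The ball `B(c i; r i)`, for `i ∈ I`, without the closed balls of half the radius around the
earlier centers. -/
def trimmedBall (I : Set ℕ) (c : ℕ → X) (r : ℕ → ℝ) (i : ℕ) : Opens X where
  carrier := {x | i ∈ I ∧ dist x (c i) < r i ∧ ∀ j < i, j ∈ I → r j / 2 < dist x (c j)}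
  is_open' := by
    have outside : ∀ j, IsOpen {x | r j / 2 < dist x (c j)} := fun j =>
      isOpen_lt continuous_const (continuous_id.dist continuous_const)
    simp only [ofPred_and, ofPred_forall]
    exact isOpen_const.inter (Metric.isOpen_ball.inter
      ((finite_lt_nat i).isOpen_biInter fun j _ => isOpen_iInter_of_finite fun _ => outside j))

theorem mem_trimmedBall : x ∈ trimmedBall I c r i ↔
    i ∈ I ∧ dist x (c i) < r i ∧ ∀ j < i, j ∈ I → r j / 2 < dist x (c j) :=
  Iff.rfl

theorem le_of_mem_trimmedBall_of_mem_halfBall {j : ℕ} (hx : x ∈ trimmedBall I c r j) (hi : i ∈ I)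
    (hxi : x ∈ Metric.ball (c i) (r i / 2)) : j ≤ i := by
  by_contra! hij
  exact (hx.2.2 i hij hi).not_gt hxi

/-- A Whitney family for `A`: the balls `B(c i; r i)`, `i ∈ I`, are small compared with their
distance from `A`, the concentric balls of half the radius cover the complement of `A`, and `y i`
is an almost nearest point of `A` for every point of the `i`-th ball. -/
structure IsWhitneyFamily (ε : ℝ) (A : Set X) (I : Set ℕ) (c : ℕ → X) (r : ℕ → ℝ) (y : ℕ → X) :
    Prop where
  radius_pos : ∀ i ∈ I, 0 < r i
  mem : ∀ i, y i ∈ A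
  two_mul_radius_le : ∀ i ∈ I, ∀ x ∈ Metric.ball (c i) (r i), 2 * r i ≤ Metric.infDist x A
  dist_le : ∀ i ∈ I, ∀ x ∈ Metric.ball (c i) (r i), dist x (y i) ≤ (1 + ε) * Metric.infDist x A
  compl_subset : Aᶜ ⊆ ⋃ i ∈ I, Metric.ball (c i) (r i / 2)

namespace IsWhitneyFamily

variable {ε : ℝ} {A : Set X} {y : ℕ → X}

theorem nonempty (h : IsWhitneyFamily ε A I c r y) : A.Nonempty := ⟨y 0, h.mem 0⟩

theorem notMem_of_mem_ball (h : IsWhitneyFamily ε A I c r y) (hi : i ∈ I)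
    (hx : x ∈ Metric.ball (c i) (r i)) : x ∉ A := fun hxA => by
  have hr := h.radius_pos i hi
  have := h.two_mul_radius_le i hi x hx
  rw [Metric.infDist_zero_of_mem hxA] at this
  linarith

theorem iUnion_halfBall (h : IsWhitneyFamily ε A I c r y) :
    ⋃ i ∈ I, Metric.ball (c i) (r i / 2) = Aᶜ := by
  refine subset_antisymm (iUnion₂_subset fun i hi x hx => ?_) h.compl_subset
  have hr := h.radius_pos i hi
  exact h.notMem_of_mem_ball hi (Metric.ball_subset_ball (by linarith) hx)

theorem iUnion_trimmedBall (h : IsWhitneyFamily ε A I c r y) :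
    ⋃ i, (trimmedBall I c r i : Set X) = Aᶜ := by
  classical
  refine subset_antisymm (iUnion_subset fun i x hx => h.notMem_of_mem_ball hx.1 hx.2.1)
    fun x hx => ?_
  have covered : ∃ i ∈ I, dist x (c i) ≤ r i / 2 := by
    obtain ⟨i, hi, hxi⟩ := mem_iUnion₂.1 (h.compl_subset hx)
    exact ⟨i, hi, (Metric.mem_ball.1 hxi).le⟩
  obtain ⟨hi, hxi⟩ := Nat.find_spec covered
  refine mem_iUnion.2 ⟨Nat.find covered, hi, ?_, fun j hj hjI => ?_⟩
  · linarith [h.radius_pos _ hi]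
  · by_contra! hle
    exact Nat.find_min covered hj ⟨hjI, hle⟩

theorem ediam_trimmedBall_le (h : IsWhitneyFamily ε A I c r y) {w : X}
    (hw : w ∈ trimmedBall I c r i) :
    Metric.ediam (trimmedBall I c r i : Set X) ≤ Metric.infEDist w A := by
  refine Metric.ediam_le fun x hx y hy => ?_
  have hxy : dist x y ≤ Metric.infDist w A := by
    linarith [dist_triangle_right x y (c i), hx.2.1, hy.2.1, h.two_mul_radius_le i hw.1 w hw.2.1]
  rw [edist_dist, ← ENNReal.ofReal_toReal (Metric.infEDist_ne_top h.nonempty)]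
  exact ENNReal.ofReal_le_ofReal hxy

end IsWhitneyFamily

end Whitney

section Dugundji

variable {X : Type*} [MetricSpace X] {ν : ℕ → X} {ε : ℝ} {A : Closeds X} {y : ℕ → X}

theorem IsWhitneyFamily.isDugundji {I : Set ℕ} {c : ℕ → X} {r : ℕ → ℝ}
    (h : IsWhitneyFamily ε (A : Set X) I c r y) (hε : 0 < ε) (hLF : IsLF ν (trimmedBall I c r)) :
    IsDugundji ν ε A (trimmedBall I c r) y where
  eps_pos := hε
  nonempty := h.nonempty
  locallyFinite := hLF
  iUnion_eq := h.iUnion_trimmedBall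
  mem := h.mem
  dist_le i x hx := h.dist_le i hx.1 x hx.2.1
  diam_tendsto n hn := by
    refine tendsto_of_tendsto_of_tendsto_of_le_of_le tendsto_const_nhds hn (fun _ => zero_le)
      fun i => ?_
    exact le_iInf₂ fun w hw => h.ediam_trimmedBall_le hw

theorem IsDugundji.mono {V : ℕ → Opens X} (h : IsDugundji ν ε A V y) {ε' : ℝ} (hε : ε ≤ ε') :
    IsDugundji ν ε' A V y where
  __ := h
  eps_pos := h.eps_pos.trans_le hε
  dist_le i x hx := (h.dist_le i x hx).trans
    (mul_le_mul_of_nonneg_right (by linarith) Metric.infDist_nonneg)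

theorem isLF_of_cover {V : ℕ → Opens X} {q : Baire}
    (cover : ⋃ j, (V j : Set X) ⊆ ⋃ i, ballNum' ν (q i))
    (le : ∀ i j, ((V j : Set X) ∩ ballNum' ν (q i)).Nonempty → j ≤ i) : IsLF ν V := by
  intro x i hx
  obtain ⟨k, hk⟩ := mem_iUnion.1 (cover (mem_iUnion.2 ⟨i, hx⟩))
  exact ⟨q k, Finset.Iic k, hk, fun j hj => by simpa using le k j hj⟩

end Dugundji

/-! ### Visible inclusion and separation of ideal balls -/

theorem toNat_sub_mul (i j m : ℕ) : (((i : ℤ) - j) * m).toNat = (i - j) * m := by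
  rcases le_total j i with hji | hij
  · rw [← Nat.cast_sub hji, ← Nat.cast_mul, Int.toNat_natCast]
  · rw [Nat.sub_eq_zero_of_le hij, zero_mul, Int.toNat_eq_zero]
    exact mul_nonpos_of_nonpos_of_nonneg (by omega) (by omega)

theorem floor_nuQ_mul (n N : ℕ) : ⌊(nuQ n : ℝ) * (N + 1)⌋₊ =
    (n.unpair.1 - n.unpair.2.unpair.1) * (N + 1) / (n.unpair.2.unpair.2 + 1) := by
  have quotient : (nuQ n : ℝ) * (N + 1) =
      (((n.unpair.1 : ℤ) - n.unpair.2.unpair.1) * (N + 1 : ℕ) : ℤ) /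
        ((n.unpair.2.unpair.2 + 1 : ℕ) : ℝ) := by
    simp only [nuQ]
    push_cast
    ring
  rw [quotient, Nat.floor_div_natCast, ← Int.floor_toNat, Int.floor_intCast, toNat_sub_mul]

theorem inv_two_pow_le_one_div (N : ℕ) : (2⁻¹ : ℝ) ^ N ≤ 1 / (N + 1) := by
  rw [inv_pow, ← one_div]
  exact one_div_le_one_div_of_le (by positivity) (by exact_mod_cast Nat.lt_two_pow_self (n := N))

theorem abs_floor_sub_lt {u t δ : ℝ} (ht : 0 ≤ t) (h : |u - t| < δ) : |⌊u⌋₊ - t| < δ + 1 := by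
  rw [abs_lt] at h ⊢
  have lower := Nat.lt_floor_add_one u
  refine ⟨by linarith, ?_⟩
  rcases le_total 0 u with hu | hu
  · linarith [Nat.floor_le hu]
  · simp only [Nat.floor_of_nonpos hu, Nat.cast_zero]
    linarith

section Visibility

variable {X : Type*} [MetricSpace X] {ν : ℕ → X} {g : ℕ × ℕ × ℕ → ℕ} {x : X} {a M c N R : ℕ}

/-- `g (a, b, N)` approximates the distance of `ν a` and `ν b` in units of `1 / (N + 1)`. -/
def ApproximatesDist (ν : ℕ → X) (g : ℕ × ℕ × ℕ → ℕ) : Prop :=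
  ∀ a b N : ℕ, |(g (a, b, N) : ℝ) - (N + 1) * dist (ν a) (ν b)| < 2

theorem IsComputableMetricSpace.exists_approximatesDist (hν : IsComputableMetricSpace ν) :
    ∃ g : ℕ × ℕ × ℕ → ℕ, Computable g ∧ ApproximatesDist ν g := by
  obtain ⟨g, hg, hgdist⟩ := hν.dist_computable
  refine ⟨fun x => ⌊(nuQ (g x) : ℝ) * (x.2.2 + 1)⌋₊, ?_, fun a b N => ?_⟩
  · simp only [floor_nuQ_mul]
    have unpair_g : Computable fun x => (g x).unpair := Computable.unpair.comp hg
    have unpair₂_g : Computable fun x => (g x).unpair.2.unpair :=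
      Computable.unpair.comp (Computable.snd.comp unpair_g)
    exact Primrec.nat_div.to_comp.comp (Primrec.nat_mul.to_comp.comp
      (Primrec.nat_sub.to_comp.comp (Computable.fst.comp unpair_g) (Computable.fst.comp unpair₂_g))
      (Computable.succ.comp (Computable.snd.comp Computable.snd)))
      (Computable.succ.comp (Computable.snd.comp unpair₂_g))
  · rw [← one_add_one_eq_two]
    refine abs_floor_sub_lt (by positivity) ?_
    have hN : (0 : ℝ) < N + 1 := by positivity
    rw [mul_comm, ← mul_sub, abs_mul, abs_of_pos hN, abs_sub_comm, ← lt_div_iff₀' hN]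
    exact (hgdist a b N).trans_le (inv_two_pow_le_one_div N)

theorem ApproximatesDist.abs_sub_lt (hg : ApproximatesDist ν g)
    (hx : dist x (ν a) ≤ 1 / (M + 1)) : |(g (a, c, M) : ℝ) - (M + 1) * dist x (ν c)| < 3 := by
  have hM : (0 : ℝ) < M + 1 := by positivity
  have shift : |(M + 1) * dist (ν a) (ν c) - (M + 1) * dist x (ν c)| ≤ 1 := by
    rw [← mul_sub, abs_mul, abs_of_pos hM, ← le_div_iff₀' hM]
    exact (abs_dist_sub_le _ _ _).trans (dist_comm x (ν a) ▸ hx)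
  linarith [hg a c M, abs_sub_le (g (a, c, M) : ℝ) ((M + 1) * dist (ν a) (ν c))
    ((M + 1) * dist x (ν c))]

/-- The approximate distance `g (a, c, M)` shows that the ball with center `ν a` and radius
`1 / (M + 1)` is contained in the ball with center `ν c` and radius `1 / (N + 1)`. -/
def VisiblyInside (g : ℕ × ℕ × ℕ → ℕ) (a M c N : ℕ) : Prop :=
  (g (a, c, M) + 3) * (N + 1) ≤ M + 1

/-- The approximate distance `g (a, c, M)` shows that the ball with center `ν a` and radius
`1 / (M + 1)` is disjoint from the closed ball with center `ν c` and radius `1 / (R + 1)`. -/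
def VisiblyOutside (g : ℕ × ℕ × ℕ → ℕ) (a M c R : ℕ) : Prop :=
  M + 1 + 3 * (R + 1) ≤ g (a, c, M) * (R + 1)

theorem visiblyInside_iff :
    VisiblyInside g a M c N ↔ (g (a, c, M) : ℝ) + 3 ≤ (M + 1) * (1 / (N + 1)) := by
  rw [mul_one_div, le_div_iff₀ (by positivity), VisiblyInside]
  exact_mod_cast Iff.rfl

theorem visiblyOutside_iff :
    VisiblyOutside g a M c R ↔ (M + 1) * (1 / (R + 1)) + 3 ≤ (g (a, c, M) : ℝ) := by
  rw [mul_one_div, div_add' _ _ _ (by positivity), div_le_iff₀ (by positivity), VisiblyOutside]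
  exact_mod_cast Iff.rfl

namespace ApproximatesDist

theorem dist_lt_of_visiblyInside (hg : ApproximatesDist ν g) (h : VisiblyInside g a M c N)
    (hx : dist x (ν a) < 1 / (M + 1)) : dist x (ν c) < 1 / (N + 1) := by
  have close := (abs_lt.1 (hg.abs_sub_lt (c := c) hx.le)).1
  have inside := visiblyInside_iff.1 h
  exact lt_of_mul_lt_mul_left (by linarith) (by positivity : (0 : ℝ) ≤ M + 1)

theorem lt_dist_of_visiblyOutside (hg : ApproximatesDist ν g) (h : VisiblyOutside g a M c R)
    (hx : dist x (ν a) < 1 / (M + 1)) : 1 / (R + 1) < dist x (ν c) := by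
  have close := (abs_lt.1 (hg.abs_sub_lt (c := c) hx.le)).2
  have outside := visiblyOutside_iff.1 h
  exact lt_of_mul_lt_mul_left (by linarith) (by positivity : (0 : ℝ) ≤ M + 1)

theorem eventually_visiblyInside (hg : ApproximatesDist ν g) (hx : dist x (ν c) < 1 / (N + 1)) :
    ∀ᶠ M : ℕ in atTop, ∀ a, dist x (ν a) < 1 / (M + 1) → VisiblyInside g a M c N := by
  filter_upwards [(tendsto_natCast_atTop_atTop.atTop_mul_const (sub_pos.2 hx)).eventually_ge_atTop
    6] with M hM a ha
  have close := (abs_lt.1 (hg.abs_sub_lt (c := c) ha.le)).2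
  exact visiblyInside_iff.2 (by linarith)

theorem eventually_visiblyOutside (hg : ApproximatesDist ν g) (hx : 1 / (R + 1) < dist x (ν c)) :
    ∀ᶠ M : ℕ in atTop, ∀ a, dist x (ν a) < 1 / (M + 1) → VisiblyOutside g a M c R := by
  filter_upwards [(tendsto_natCast_atTop_atTop.atTop_mul_const (sub_pos.2 hx)).eventually_ge_atTop
    6] with M hM a ha
  have close := (abs_lt.1 (hg.abs_sub_lt (c := c) ha.le)).1
  exact visiblyOutside_iff.2 (by linarith)

end ApproximatesDist

end Visibility

/-! ### Names of covers by trimmed balls -/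

/-- The `α`-index of the ball with center `ν a` and radius `1 / (M + 1)`. -/
def ballIndex (a M : ℕ) : ℕ := Nat.pair a (Nat.pair 0 M)

/-- The sequence of radii `1 / (N i + 1)`. -/
def reciprocalRadius (N : ℕ → ℕ) (i : ℕ) : ℝ := 1 / (N i + 1)

theorem reciprocalRadius_half (N : ℕ → ℕ) (i : ℕ) :
    reciprocalRadius N i / 2 = 1 / ((2 * N i + 1 : ℕ) + 1) := by
  rw [reciprocalRadius, div_div]
  push_cast
  ring

/-- The ball with center `ν a` and radius `1 / (M + 1)` is visibly contained in the `i`-th trimmed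
ball for the centers `ν (c j)` and the radii `1 / (N j + 1)`. -/
def IsPiece (g : ℕ × ℕ × ℕ → ℕ) (I : Set ℕ) (c N : ℕ → ℕ) (i a M : ℕ) : Prop :=
  (i ∈ I ∧ VisiblyInside g a M (c i) (N i)) ∧
    ∀ j < i, j ∈ I → VisiblyOutside g a M (c j) (2 * N j + 1)

open Classical in
/-- A name of the `i`-th trimmed ball: it lists the ideal balls visibly contained in it. -/
def trimmedBallName (g : ℕ × ℕ × ℕ → ℕ) (I : Set ℕ) (c N : ℕ → ℕ) (i : ℕ) : Baire := fun k =>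
  if IsPiece g I c N i k.unpair.1 k.unpair.2 then ballIndex k.unpair.1 k.unpair.2 + 1 else 0

open Classical in
/-- The sequence of `α'`-indices of the balls of half the radius, and of `∅` for indices not in
`I`. -/
def halfBallName (I : Set ℕ) (c N : ℕ → ℕ) : Baire := fun i =>
  if i ∈ I then ballIndex (c i) (2 * N i + 1) + 1 else 0

/-- A name of the sequence of trimmed balls. As the `j`-th of them misses the `i`-th half ball for
`i < j`, the finite set listed with the `i`-th half ball is `{0, …, i}`. -/
def coverName (g : ℕ × ℕ × ℕ → ℕ) (I : Set ℕ) (c N : ℕ → ℕ) : Baire :=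
  pairName (tupleName (trimmedBallName g I c N))
    (pairName (halfBallName I c N) fun i => 2 ^ (i + 1) - 1)

section Cover

variable {X : Type*} [MetricSpace X] {ν : ℕ → X} {g : ℕ × ℕ × ℕ → ℕ} {I : Set ℕ} {c N : ℕ → ℕ}

theorem ballNum_ballIndex (ν : ℕ → X) (a M : ℕ) :
    ballNum ν (ballIndex a M) = Metric.ball (ν a) (1 / ((M : ℝ) + 1)) := by
  simp [ballNum, ballIndex, nuQPos]

theorem ballNum'_halfBallName (ν : ℕ → X) (I : Set ℕ) (c N : ℕ → ℕ) (i : ℕ) :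
    ballNum' ν (halfBallName I c N i) =
      ⋃ _ : i ∈ I, Metric.ball (ν (c i)) (reciprocalRadius N i / 2) := by
  by_cases hi : i ∈ I
  · simp only [halfBallName, hi, if_true, ballNum', ballNum_ballIndex, reciprocalRadius_half,
      iUnion_true]
  · simp only [halfBallName, hi, if_false, ballNum', iUnion_false]

theorem mem_trimmedBall_iff_exists_isPiece (hν : DenseRange ν) (hg : ApproximatesDist ν g)
    {i : ℕ} {x : X} : x ∈ trimmedBall I (ν ∘ c) (reciprocalRadius N) i ↔
      ∃ a M, IsPiece g I c N i a M ∧ dist x (ν a) < 1 / ((M : ℝ) + 1) := by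
  simp only [mem_trimmedBall, reciprocalRadius_half, Function.comp_apply]
  constructor
  · rintro ⟨hi, inside, outside⟩
    have eventually_outside : ∀ᶠ M : ℕ in atTop, ∀ j < i, j ∈ I → ∀ a,
        dist x (ν a) < 1 / ((M : ℝ) + 1) → VisiblyOutside g a M (c j) (2 * N j + 1) :=
      (eventually_all_finite (finite_lt_nat i)).2 fun j hj => eventually_imp_distrib_left.2
        fun hjI => hg.eventually_visiblyOutside (outside j hj hjI)
    obtain ⟨M, visibly_inside, visibly_outside⟩ :=
      ((hg.eventually_visiblyInside inside).and eventually_outside).exists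
    obtain ⟨a, ha⟩ := hν.exists_dist_lt x (ε := 1 / ((M : ℝ) + 1)) (by positivity)
    exact ⟨a, M, ⟨⟨hi, visibly_inside a ha⟩, fun j hj hjI => visibly_outside j hj hjI a ha⟩, ha⟩
  · rintro ⟨a, M, ⟨⟨hi, inside⟩, outside⟩, ha⟩
    exact ⟨hi, hg.dist_lt_of_visiblyInside inside ha, fun j hj hjI =>
      hg.lt_dist_of_visiblyOutside (outside j hj hjI) ha⟩

theorem openRep_trimmedBallName (hν : DenseRange ν) (hg : ApproximatesDist ν g) (i : ℕ) :
    openRep ν (trimmedBallName g I c N i) (trimmedBall I (ν ∘ c) (reciprocalRadius N) i) := by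
  ext x
  rw [SetLike.mem_coe, mem_trimmedBall_iff_exists_isPiece hν hg]
  simp only [mem_iUnion₂, mem_ofPred_eq]
  constructor
  · rintro ⟨a, M, piece, ha⟩
    refine ⟨Nat.pair a M, ?_⟩
    simpa [trimmedBallName, piece, ballNum_ballIndex] using ha
  · rintro ⟨k, hk, hx⟩
    by_cases piece : IsPiece g I c N i k.unpair.1 k.unpair.2
    · refine ⟨_, _, piece, ?_⟩
      simpa [trimmedBallName, piece, ballNum_ballIndex] using hx
    · simp [trimmedBallName, piece] at hk

theorem le_of_trimmedBall_inter_ballNum'_nonempty {i j : ℕ}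
    (h : ((trimmedBall I (ν ∘ c) (reciprocalRadius N) j : Set X) ∩
      ballNum' ν (halfBallName I c N i)).Nonempty) : j ≤ i := by
  obtain ⟨x, hxj, hxi⟩ := h
  rw [ballNum'_halfBallName, mem_iUnion] at hxi
  exact le_of_mem_trimmedBall_of_mem_halfBall hxj hxi.1 hxi.2

namespace IsWhitneyFamily

variable {ε : ℝ} {A : Set X} {y : ℕ → X}

theorem iUnion_trimmedBall_eq_iUnion_ballNum'
    (h : IsWhitneyFamily ε A I (ν ∘ c) (reciprocalRadius N) y) :
    ⋃ j, (trimmedBall I (ν ∘ c) (reciprocalRadius N) j : Set X) =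
      ⋃ i, ballNum' ν (halfBallName I c N i) := by
  simp only [h.iUnion_trimmedBall, ballNum'_halfBallName, ← h.iUnion_halfBall,
    Function.comp_apply]

theorem isLF_trimmedBall (h : IsWhitneyFamily ε A I (ν ∘ c) (reciprocalRadius N) y) :
    IsLF ν (trimmedBall I (ν ∘ c) (reciprocalRadius N)) :=
  isLF_of_cover h.iUnion_trimmedBall_eq_iUnion_ballNum'.subset
    fun _ _ => le_of_trimmedBall_inter_ballNum'_nonempty

theorem lfRep₂_coverName (h : IsWhitneyFamily ε A I (ν ∘ c) (reciprocalRadius N) y)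
    (hν : DenseRange ν) (hg : ApproximatesDist ν g) :
    lfRep₂ ν (coverName g I c N) (trimmedBall I (ν ∘ c) (reciprocalRadius N)) := by
  simp only [lfRep₂, lfRep₁, powRep, coverName, fstName_pairName, sndName_pairName,
    compName_tupleName]
  refine ⟨⟨h.isLF_trimmedBall, openRep_trimmedBallName hν hg,
    h.iUnion_trimmedBall_eq_iUnion_ballNum'.subset, fun i j hj => ?_⟩,
    h.iUnion_trimmedBall_eq_iUnion_ballNum'⟩
  change (2 ^ (i + 1) - 1).testBit j = true
  rw [Nat.testBit_two_pow_sub_one, decide_eq_true_iff]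
  exact Nat.lt_succ_of_le (le_of_trimmedBall_inter_ballNum'_nonempty hj)

end IsWhitneyFamily

end Cover

section Computability

variable {α : Type*} [Primcodable α] {g : ℕ × ℕ × ℕ → ℕ}

theorem ComputablePredicate.visiblyInside (hg : Computable g) {a M c N : Baire → α → ℕ}
    (ha : ComputableFunctional a) (hM : ComputableFunctional M) (hc : ComputableFunctional c)
    (hN : ComputableFunctional N) :
    ComputablePredicate fun s x => VisiblyInside g (a s x) (M s x) (c s x) (N s x) :=
  (((ha.pair (hc.pair hM)).map hg).add (.const 3)).mul (hN.add (.const 1)) |>.le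
    (hM.add (.const 1))

theorem ComputablePredicate.visiblyOutside (hg : Computable g) {a M c R : Baire → α → ℕ}
    (ha : ComputableFunctional a) (hM : ComputableFunctional M) (hc : ComputableFunctional c)
    (hR : ComputableFunctional R) :
    ComputablePredicate fun s x => VisiblyOutside g (a s x) (M s x) (c s x) (R s x) :=
  (hM.add (.const 1)).add ((ComputableFunctional.const 3).mul (hR.add (.const 1))) |>.le
    (((ha.pair (hc.pair hM)).map hg).mul (hR.add (.const 1)))

variable {I : Baire → Set ℕ} {c N : ℕ → ℕ}

theorem ComputablePredicate.isPiece (hg : Computable g)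
    (hI : ComputablePredicate fun s i => i ∈ I s) (hc : Computable c) (hN : Computable N)
    {i a M : Baire → α → ℕ} (hi : ComputableFunctional i) (ha : ComputableFunctional a)
    (hM : ComputableFunctional M) :
    ComputablePredicate fun s x => IsPiece g (I s) c N (i s x) (a s x) (M s x) := by
  have earlier : ComputableFunctional fun (_ : Baire) (x : α × ℕ) => x.1 :=
    .of_computable .fst
  have j : ComputableFunctional fun (_ : Baire) (x : α × ℕ) => x.2 := .of_computable .snd
  refine .and (.and (hI.comp hi) (.visiblyInside hg ha hM (hi.map hc) (hi.map hN))) ?_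
  refine .forall_lt (P := fun s x j => j ∈ I s →
    VisiblyOutside g (a s x) (M s x) (c j) (2 * N j + 1)) (.imp (hI.comp j) ?_) hi
  exact .visiblyOutside hg (ha.comp earlier) (hM.comp earlier) (j.map hc)
    (((ComputableFunctional.const 2).mul (j.map hN)).add (.const 1))

namespace ComputableFunctional

theorem ballIndex {a M : Baire → α → ℕ} (ha : ComputableFunctional a)
    (hM : ComputableFunctional M) : ComputableFunctional fun s x => ballIndex (a s x) (M s x) :=
  ha.natPair ((const 0).natPair hM)

theorem trimmedBallName (hg : Computable g) (hI : ComputablePredicate fun s i => i ∈ I s)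
    (hc : Computable c) (hN : Computable N) :
    ComputableFunctional fun s (x : ℕ × ℕ) => trimmedBallName g (I s) c N x.1 x.2 := by
  have entry : Computable fun x : ℕ × ℕ => x.2.unpair := Computable.unpair.comp .snd
  have a : ComputableFunctional fun (_ : Baire) (x : ℕ × ℕ) => x.2.unpair.1 :=
    of_computable (Computable.fst.comp entry)
  have M : ComputableFunctional fun (_ : Baire) (x : ℕ × ℕ) => x.2.unpair.2 :=
    of_computable (Computable.snd.comp entry)
  classical
  exact ite (.isPiece hg hI hc hN (of_computable .fst) a M) ((ballIndex a M).add (const 1))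
    (const 0)

theorem halfBallName (hI : ComputablePredicate fun s i => i ∈ I s) (hc : Computable c)
    (hN : Computable N) : ComputableFunctional fun s => halfBallName (I s) c N := by
  classical
  exact ite hI (ballIndex (of_computable hc)
    (((const 2).mul (of_computable hN)).add (const 1)) |>.add (const 1)) (const 0)

theorem coverName (hg : Computable g) (hI : ComputablePredicate fun s i => i ∈ I s)
    (hc : Computable c) (hN : Computable N) :
    ComputableFunctional fun s => coverName g (I s) c N := by
  have two_pow : Computable fun i : ℕ => 2 ^ (i + 1) :=
    (Primrec₂.unpaired'.1 Nat.Primrec.pow).to_comp.comp (.const 2) .succ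
  have initialSegment : ComputableFunctional fun (_ : Baire) (i : ℕ) => 2 ^ (i + 1) - 1 :=
    (of_computable two_pow).sub (const 1)
  exact (tupleName (trimmedBallName hg hI hc hN)).pairName
    ((halfBallName hI hc hN).pairName initialSegment)

end ComputableFunctional

end Computability

/-! ### Reading names of closed sets -/

/-- The application of `p` to `q` finds its `n`-th output symbol to be `m` from the first `k`
symbols of `q`, and not from fewer. -/
def Outputs (p q : Baire) (n k m : ℕ) : Prop :=
  (∀ l < k, answer p q n l = 0) ∧ answer p q n k = m + 1

theorem apply_eq_iff_exists_outputs {p q r : Baire} (hr : r ∈ eta p q) {n m : ℕ} :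
    r n = m ↔ ∃ k, Outputs p q n k m := by
  obtain ⟨defined, rfl⟩ := hr
  change answer p q n (Nat.find (defined n)) - 1 = m ↔ _
  have found := Nat.find_spec (defined n)
  constructor
  · intro h
    exact ⟨_, fun l hl => not_not.1 (Nat.find_min (defined n) hl), by omega⟩
  · rintro ⟨k, none_before, hk⟩
    have first : Nat.find (defined n) = k :=
      (Nat.find_eq_iff _).2 ⟨by omega, fun l hl => not_not.2 (none_before l hl)⟩
    rw [first, hk, Nat.add_sub_cancel]

section ClosedSets

variable {X : Type*} [MetricSpace X] {ν : ℕ → X} {A : Closeds X}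

theorem cauchyRep_const (ν : ℕ → X) (c : ℕ) : cauchyRep ν (fun _ => c) (ν c) :=
  ⟨fun i j => by simp, tendsto_const_nhds⟩

theorem cauchyRep.dist_le {p : Baire} {x : X} (h : cauchyRep ν p x) (N : ℕ) :
    dist x (ν (p N)) ≤ 2⁻¹ ^ N := by
  refine le_of_tendsto (h.2.dist tendsto_const_nhds) ?_
  filter_upwards [eventually_ge_atTop N] with i hi
  simpa only [min_eq_right hi] using (h.1 i N).le

theorem distFun_eq (hA : (A : Set X).Nonempty) (x : X) :
    distFun A x = (Metric.infDist x (A : Set X) : EReal) := by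
  rw [distFun, Metric.infDist, ← EReal.toReal_coe_ennreal, EReal.coe_toReal]
  · exact EReal.coe_ennreal_eq_top_iff.not.2 (Metric.infEDist_ne_top hA)
  · exact EReal.coe_ennreal_ne_bot _

theorem distRep.lt_infDist_iff {p : Baire} (h : distRep ν p A) (hA : (A : Set X).Nonempty)
    {c m : ℕ} : (nuQ m : ℝ) < Metric.infDist (ν c) (A : Set X) ↔
      ∃ n k, Outputs p (fun _ => c) n k (m + 1) := by
  obtain ⟨r, hr, lower⟩ := h _ _ (cauchyRep_const ν c)
  have listed := Set.ext_iff.1 lower m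
  rw [mem_ofPred_eq, distFun_eq hA, EReal.coe_lt_coe_iff] at listed
  rw [listed]
  refine exists_congr fun n => ?_
  rw [← apply_eq_iff_exists_outputs hr]
  omega

theorem nuQ_pair (T N : ℕ) : (nuQ (Nat.pair T (Nat.pair 0 N)) : ℝ) = T / (N + 1) := by
  simp [nuQ]

theorem distRep.exists_outputs_level {p : Baire} (h : distRep ν p A) (hA : (A : Set X).Nonempty)
    {x : X} {c N : ℕ} (hc : dist x (ν c) < 1 / ((N : ℝ) + 1))
    (hx : 1 ≤ ((N : ℝ) + 1) * Metric.infDist x (A : Set X)) :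
    ∃ T n k : ℕ, (N + 1) * Metric.infDist x (A : Set X) - 2 < T ∧
      Outputs p (fun _ => c) n k (Nat.pair T (Nat.pair 0 N) + 1) := by
  have hu : (0 : ℝ) < N + 1 := by positivity
  set T := ⌊((N : ℝ) + 1) * Metric.infDist x (A : Set X) - 1⌋₊
  have floor_le : (T : ℝ) ≤ (N + 1) * Metric.infDist x (A : Set X) - 1 :=
    Nat.floor_le (by linarith)
  have lt_floor := Nat.lt_floor_add_one (((N : ℝ) + 1) * Metric.infDist x (A : Set X) - 1)
  have level_lt : (T : ℝ) / (N + 1) < Metric.infDist (ν c) (A : Set X) := by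
    have triangle := mul_le_mul_of_nonneg_left
      (Metric.infDist_le_infDist_add_dist (s := (A : Set X)) (x := x) (y := ν c)) hu.le
    rw [lt_div_iff₀' hu] at hc
    rw [div_lt_iff₀' hu]
    linarith
  rw [← nuQ_pair, h.lt_infDist_iff hA] at level_lt
  obtain ⟨n, k, outputs⟩ := level_lt
  exact ⟨T, n, k, by linarith, outputs⟩

theorem rangeRep.exists_dense_seq {s : Baire} (h : rangeRep ν s A) (hA : (A : Set X).Nonempty) :
    ∃ z : ℕ → X, (∀ j, z j ∈ A) ∧ (∀ j, cauchyRep ν (fun k => compName s j k - 1) (z j)) ∧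
      (A : Set X) ⊆ closure (range z) := by
  obtain ⟨hempty, -⟩ | ⟨-, points, dense⟩ := h
  · exact absurd hempty hA.ne_empty
  choose _ z hz names using points
  refine ⟨z, hz, names, fun x hx => mem_closure_iff.2 fun U hU hxU => ?_⟩
  obtain ⟨j, w, hwU, hw⟩ := dense x hx U hU hxU
  exact ⟨w, hwU, j, tendsto_nhds_unique (names j).2 hw.2⟩

end ClosedSets

/-! ### Admissible candidates -/

/-- The `δ_dist^>`-name contained in the input `s = a.⟨p, q⟩`. -/
def distanceName (s : Baire) : Baire := sndName fun n => s (n + 1)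

/-- The name of the `j`-th point contained in the input `s = a.⟨p, q⟩`. -/
def pointName (s : Baire) (j : ℕ) : Baire := fun k => compName (fstName fun n => s (n + 1)) j k - 1

/-- The number `E` for which the system constructed from the input `s` has the coefficient
`1 + 1 / (E + 1)`; it is the denominator of the rational number given in `s`, minus `1`. -/
def slack (s : Baire) : ℕ := (s 0).unpair.2.unpair.2

theorem one_div_slack_le {s : Baire} (hs : 0 < nuQ (s 0)) :
    1 / ((slack s : ℝ) + 1) ≤ nuQ (s 0) := by
  simp only [nuQ, slack] at hs ⊢
  push_cast
  rw [div_pos_iff_of_pos_right (by positivity), sub_pos, Nat.cast_lt] at hs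
  gcongr
  rw [le_sub_iff_add_le, add_comm]
  exact_mod_cast hs

theorem one_div_slack_le_one (s : Baire) : 1 / ((slack s : ℝ) + 1) ≤ 1 :=
  div_le_one_of_le₀ (by simp) (by positivity)

/-- A candidate for a ball of a Whitney family: the ball has center `ν center` and radius
`1 / (scale + 1)`, the attached point of the closed set is the one with number `site`, and the
distance of the center from the closed set should be found to exceed `level / (scale + 1)` at the
output position `place` after reading `steps` symbols. -/
structure Candidate where
  center : ℕ
  scale : ℕ
  level : ℕ
  site : ℕ
  place : ℕ
  steps : ℕ

/-- The enumeration of all candidates. -/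
def candidate (i : ℕ) : Candidate where
  center := i.unpair.1
  scale := i.unpair.2.unpair.1
  level := i.unpair.2.unpair.2.unpair.1
  site := i.unpair.2.unpair.2.unpair.2.unpair.1
  place := i.unpair.2.unpair.2.unpair.2.unpair.2.unpair.1
  steps := i.unpair.2.unpair.2.unpair.2.unpair.2.unpair.2

theorem candidate_surjective : Function.Surjective candidate := fun q =>
  ⟨Nat.pair q.center (Nat.pair q.scale (Nat.pair q.level (Nat.pair q.site
    (Nat.pair q.place q.steps)))), by simp only [candidate, Nat.unpair_pair]⟩

/-- The input shows that the ball of the candidate is small compared with its distance from the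
closed set and that the attached point is almost a nearest one. The inequality says
`G + 4 ≤ (1 + 1 / (E + 1)) (T - 1)`, where `G / (scale + 1)` is the approximate distance of the
center from the attached point, `E` is the slack and `T` the level. The constants `4` and `1` absorb
the errors of the approximations and the radius. -/
def Candidate.IsAdmissible (g : ℕ × ℕ × ℕ → ℕ) (s : Baire) (q : Candidate) : Prop :=
  Outputs (distanceName s) (fun _ => q.center) q.place q.steps
      (Nat.pair q.level (Nat.pair 0 q.scale) + 1) ∧
    (g (pointName s q.site q.scale, q.center, q.scale) + 4) * (slack s + 1) + (slack s + 2) ≤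
      (slack s + 2) * q.level

theorem mul_succ_add_le_mul_iff (G E T : ℕ) :
    (G + 4) * (E + 1) + (E + 2) ≤ (E + 2) * T ↔
      (G : ℝ) + 4 ≤ (1 + 1 / ((E : ℝ) + 1)) * (T - 1) := by
  have hE : (0 : ℝ) < E + 1 := by positivity
  have coefficient : (1 + 1 / ((E : ℝ) + 1)) * (T - 1) = (E + 2) * (T - 1) / (E + 1) := by
    field_simp
    ring
  rw [coefficient, le_div_iff₀ hE, mul_sub, mul_one, le_sub_iff_add_le]
  exact_mod_cast Iff.rfl

section Admissible

variable {X : Type*} [MetricSpace X] {ν : ℕ → X} {g : ℕ × ℕ × ℕ → ℕ} {s : Baire} {A : Closeds X}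
  {z : ℕ → X} {q : Candidate} {x : X}

namespace Candidate.IsAdmissible

theorem level_lt (h : q.IsAdmissible g s) (hA : (A : Set X).Nonempty)
    (hdist : distRep ν (distanceName s) A) :
    (q.level : ℝ) < (q.scale + 1) * Metric.infDist (ν q.center) (A : Set X) := by
  have := (hdist.lt_infDist_iff hA).2 ⟨_, _, h.1⟩
  rwa [nuQ_pair, div_lt_iff₀' (by positivity)] at this

theorem level_sub_one_lt (h : q.IsAdmissible g s) (hA : (A : Set X).Nonempty)
    (hdist : distRep ν (distanceName s) A) (hx : dist x (ν q.center) < 1 / (q.scale + 1)) :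
    (q.level : ℝ) - 1 < (q.scale + 1) * Metric.infDist x (A : Set X) := by
  have hu : (0 : ℝ) < q.scale + 1 := by positivity
  have near : (q.scale + 1) * dist x (ν q.center) < 1 := (lt_div_iff₀' hu).1 hx
  have triangle := mul_le_mul_of_nonneg_left
    (Metric.infDist_le_infDist_add_dist (s := (A : Set X)) (x := ν q.center) (y := x)) hu.le
  rw [dist_comm] at triangle
  linarith [h.level_lt hA hdist]

theorem mul_radius_le (h : q.IsAdmissible g s) (hA : (A : Set X).Nonempty)
    (hdist : distRep ν (distanceName s) A) (hx : dist x (ν q.center) < 1 / (q.scale + 1)) :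
    2 * (1 / ((q.scale : ℝ) + 1)) ≤ Metric.infDist x (A : Set X) := by
  have budget := (mul_succ_add_le_mul_iff _ _ _).1 h.2
  have two_le : 2 ≤ (q.level : ℝ) - 1 := by
    have := one_div_slack_le_one s
    have : (0 : ℝ) < 1 / (slack s + 1) := by positivity
    have : (0 : ℝ) ≤ g (pointName s q.site q.scale, q.center, q.scale) := Nat.cast_nonneg _
    by_contra! small
    nlinarith
  rw [mul_one_div, div_le_iff₀' (by positivity)]
  exact two_le.trans (h.level_sub_one_lt hA hdist hx).le

theorem dist_site_le (h : q.IsAdmissible g s) (hA : (A : Set X).Nonempty)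
    (hdist : distRep ν (distanceName s) A) (hg : ApproximatesDist ν g)
    (hz : ∀ j, cauchyRep ν (pointName s j) (z j))
    (hx : dist x (ν q.center) < 1 / (q.scale + 1)) :
    dist x (z q.site) ≤ (1 + 1 / ((slack s : ℝ) + 1)) * Metric.infDist x (A : Set X) := by
  have hu : (0 : ℝ) < q.scale + 1 := by positivity
  have approx := (abs_lt.1 (hg.abs_sub_lt (c := q.center)
    (((hz q.site).dist_le q.scale).trans (inv_two_pow_le_one_div q.scale)))).1
  have near : (q.scale + 1) * dist x (ν q.center) < 1 := (lt_div_iff₀' hu).1 hx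
  have triangle := mul_le_mul_of_nonneg_left (dist_triangle_right x (z q.site) (ν q.center)) hu.le
  have bound := mul_lt_mul_of_pos_left (h.level_sub_one_lt hA hdist hx)
    (by positivity : 0 < 1 + 1 / ((slack s : ℝ) + 1))
  have budget := (mul_succ_add_le_mul_iff _ _ _).1 h.2
  refine le_of_mul_le_mul_left (a := (q.scale : ℝ) + 1) ?_ hu
  linarith

end Candidate.IsAdmissible

theorem exists_lt_mul_infDist {κ : ℝ} (hκ : 1 < κ) (hx : 0 < Metric.infDist x (A : Set X))
    (hA : (A : Set X).Nonempty) (hdense : (A : Set X) ⊆ closure (range z)) :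
    ∃ j, dist x (z j) < κ * Metric.infDist x (A : Set X) := by
  obtain ⟨y, hy, hxy⟩ := (Metric.infDist_lt_iff hA).1 (lt_mul_of_one_lt_left hx hκ)
  obtain ⟨_, ⟨j, rfl⟩, hj⟩ := Metric.mem_closure_iff.1 (hdense hy) _ (sub_pos.2 hxy)
  exact ⟨j, by linarith [dist_triangle x y (z j)]⟩

theorem exists_isAdmissible (hν : DenseRange ν) (hg : ApproximatesDist ν g)
    (hA : (A : Set X).Nonempty) (hdist : distRep ν (distanceName s) A)
    (hz : ∀ j, cauchyRep ν (pointName s j) (z j)) (hdense : (A : Set X) ⊆ closure (range z))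
    (hx : x ∉ A) : ∃ q : Candidate, q.IsAdmissible g s ∧
      dist x (ν q.center) < 1 / ((q.scale : ℝ) + 1) / 2 := by
  have hδ : 0 < 1 / ((slack s : ℝ) + 1) := by positivity
  have hδ1 := one_div_slack_le_one s
  have budget_iff := mul_succ_add_le_mul_iff (E := slack s)
  set δ := 1 / ((slack s : ℝ) + 1)
  set D := Metric.infDist x (A : Set X)
  have hD : 0 < D := (A.isClosed.notMem_iff_infDist_pos hA).1 hx
  obtain ⟨j, hj⟩ := exists_lt_mul_infDist (lt_add_of_pos_right 1 hδ) hD hA hdense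
  have eventually_large {t : ℝ} (ht : 0 < t) (b : ℝ) : ∀ᶠ N : ℕ in atTop, b ≤ N * t :=
    (tendsto_natCast_atTop_atTop.atTop_mul_const ht).eventually_ge_atTop b
  obtain ⟨N, hND, hNj⟩ :=
    ((eventually_large hD 1).and (eventually_large (sub_pos.2 hj) 14)).exists
  have hu : (0 : ℝ) < N + 1 := by positivity
  obtain ⟨c, hc⟩ := hν.exists_dist_lt x (ε := 1 / ((N : ℝ) + 1) / 2) (by positivity)
  have near : ((N : ℝ) + 1) * dist x (ν c) < 1 / 2 := by
    rwa [div_div, mul_comm, ← div_div, lt_div_iff₀' hu] at hc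
  obtain ⟨T, n, k, hT, outputs⟩ := hdist.exists_outputs_level hA
    (hc.trans (half_lt_self (by positivity))) (by linarith : 1 ≤ ((N : ℝ) + 1) * D)
  refine ⟨⟨c, N, T, j, n, k⟩, ⟨outputs, (budget_iff _ _).2 ?_⟩, hc⟩
  have approx := (abs_lt.1 (hg.abs_sub_lt (c := c)
    (((hz j).dist_le N).trans (inv_two_pow_le_one_div N)))).2
  have triangle := mul_le_mul_of_nonneg_left (dist_triangle_left (z j) (ν c) x) hu.le
  have bound := mul_le_mul_of_nonneg_left (by linarith : (N + 1) * D - 3 ≤ (T : ℝ) - 1)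
    (by positivity : 0 ≤ 1 + δ)
  dsimp only
  linarith

end Admissible

/-- The numbers of the admissible candidates. -/
def admissibleIndices (g : ℕ × ℕ × ℕ → ℕ) (s : Baire) : Set ℕ :=
  {i | (candidate i).IsAdmissible g s}

theorem isWhitneyFamily_admissibleIndices {X : Type*} [MetricSpace X] {ν : ℕ → X}
    {g : ℕ × ℕ × ℕ → ℕ} {s : Baire} {A : Closeds X} {z : ℕ → X} (hν : DenseRange ν)
    (hg : ApproximatesDist ν g) (hA : (A : Set X).Nonempty) (hdist : distRep ν (distanceName s) A)
    (hzA : ∀ j, z j ∈ A) (hz : ∀ j, cauchyRep ν (pointName s j) (z j))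
    (hdense : (A : Set X) ⊆ closure (range z)) :
    IsWhitneyFamily (1 / ((slack s : ℝ) + 1)) (A : Set X) (admissibleIndices g s)
      (ν ∘ fun i => (candidate i).center) (reciprocalRadius fun i => (candidate i).scale)
      (fun i => z (candidate i).site) where
  radius_pos _ _ := Nat.one_div_pos_of_nat
  mem _ := hzA _
  two_mul_radius_le _ hi _ hx := hi.mul_radius_le hA hdist hx
  dist_le _ hi _ hx := hi.dist_site_le hA hdist hg hz hx
  compl_subset _ hx := by
    obtain ⟨q, hq, near⟩ := exists_isAdmissible hν hg hA hdist hz hdense hx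
    obtain ⟨i, rfl⟩ := candidate_surjective q
    exact mem_iUnion₂.2 ⟨i, hq, near⟩

/-! ### Computability of the construction -/

section Computability

theorem computable_unpair_fst : Computable fun i : ℕ => i.unpair.1 :=
  Computable.fst.comp .unpair

theorem computable_unpair_snd : Computable fun i : ℕ => i.unpair.2 :=
  Computable.snd.comp .unpair

namespace Candidate

theorem computable_center : Computable fun i => (candidate i).center :=
  computable_unpair_fst

theorem computable_scale : Computable fun i => (candidate i).scale :=
  computable_unpair_fst.comp computable_unpair_snd

theorem computable_level : Computable fun i => (candidate i).level :=
  computable_scale.comp computable_unpair_snd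

theorem computable_site : Computable fun i => (candidate i).site :=
  computable_level.comp computable_unpair_snd

theorem computable_place : Computable fun i => (candidate i).place :=
  computable_site.comp computable_unpair_snd

theorem computable_steps : Computable fun i => (candidate i).steps := by
  have rest := computable_unpair_snd.comp computable_unpair_snd
  simpa only [candidate] using rest.comp (rest.comp computable_unpair_snd)

end Candidate

namespace ComputableFunctional

theorem distanceName : ComputableFunctional distanceName :=
  apply (f := fun _ n => 2 * n + 1 + 1)
    ((((const 2).mul (of_computable .id)).add (const 1)).add (const 1))

variable {α : Type*} [Primcodable α]

theorem pointName {j k : Baire → α → ℕ} (hj : ComputableFunctional j)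
    (hk : ComputableFunctional k) : ComputableFunctional fun s x => pointName s (j s x) (k s x) :=
  (apply (((const 2).mul (hj.natPair hk)).add (const 1))).sub (const 1)

theorem slack : ComputableFunctional fun s (_ : α) => slack s :=
  map (f := fun n : ℕ => n.unpair.2.unpair.2)
    (computable_unpair_snd.comp computable_unpair_snd)
    (apply (const 0))

theorem answer_const {p : Baire → Baire} (hp : ComputableFunctional p) {c n k : Baire → α → ℕ}
    (hc : ComputableFunctional c) (hn : ComputableFunctional n) (hk : ComputableFunctional k) :
    ComputableFunctional fun s x => answer (p s) (fun _ => c s x) (n s x) (k s x) := by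
  have word : Computable₂ fun c k : ℕ => Encodable.encode ((List.range k).map fun _ => c) :=
    Computable.encode.comp (Primrec.list_map (Primrec.list_range.comp .snd)
      (Primrec.fst.comp .fst).to₂).to_comp
  exact hp.comp (hn.natPair (map₂ word hc hk))

end ComputableFunctional

namespace ComputablePredicate

theorem outputs_const {α : Type*} [Primcodable α] {p : Baire → Baire}
    (hp : ComputableFunctional p) {c n k m : Baire → α → ℕ}
    (hc : ComputableFunctional c) (hn : ComputableFunctional n) (hk : ComputableFunctional k)
    (hm : ComputableFunctional m) :
    ComputablePredicate fun s x => Outputs (p s) (fun _ => c s x) (n s x) (k s x) (m s x) := by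
  have base : ComputableFunctional fun (_ : Baire) (x : α × ℕ) => x.1 := .of_computable .fst
  have fewer : ComputableFunctional fun (_ : Baire) (x : α × ℕ) => x.2 := .of_computable .snd
  refine .and (.forall_lt (P := fun s x l => answer (p s) (fun _ => c s x) (n s x) l = 0) ?_ hk) ?_
  · exact (ComputableFunctional.answer_const hp (hc.comp base) (hn.comp base) fewer).eq (.const 0)
  · exact (ComputableFunctional.answer_const hp hc hn hk).eq (hm.add (.const 1))

theorem mem_admissibleIndices {g : ℕ × ℕ × ℕ → ℕ} (hg : Computable g) :
    ComputablePredicate fun s i => i ∈ admissibleIndices g s := by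
  have center := ComputableFunctional.of_computable Candidate.computable_center
  have scale := ComputableFunctional.of_computable Candidate.computable_scale
  have level := ComputableFunctional.of_computable Candidate.computable_level
  have site := ComputableFunctional.of_computable Candidate.computable_site
  have place := ComputableFunctional.of_computable Candidate.computable_place
  have steps := ComputableFunctional.of_computable Candidate.computable_steps
  have siteDist : ComputableFunctional fun s i => g (pointName s (candidate i).site
      (candidate i).scale, (candidate i).center, (candidate i).scale) :=
    .map hg ((ComputableFunctional.pointName site scale).pair (center.pair scale))
  have slack_add_two := (ComputableFunctional.slack (α := ℕ)).add (.const 2)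
  refine .and (outputs_const .distanceName center place steps
    ((level.natPair ((ComputableFunctional.const 0).natPair scale)).add (.const 1))) ?_
  exact (((siteDist.add (.const 4)).mul (.add .slack (.const 1))).add slack_add_two).le
    (slack_add_two.mul level)

end ComputablePredicate

end Computability

/-- A `δ₃`-name of the Dugundji system constructed from the input `s`. -/
def dugundjiName (g : ℕ × ℕ × ℕ → ℕ) (s : Baire) : Baire :=
  pairName (coverName g (admissibleIndices g s) (fun i => (candidate i).center)
    fun i => (candidate i).scale) (tupleName fun i => pointName s (candidate i).site)

theorem ComputableFunctional.dugundjiName {g : ℕ × ℕ × ℕ → ℕ} (hg : Computable g) :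
    ComputableFunctional (dugundjiName g) := by
  have site : ComputableFunctional fun (_ : Baire) (x : ℕ × ℕ) => (candidate x.1).site :=
    .of_computable (Candidate.computable_site.comp .fst)
  exact (coverName hg (.mem_admissibleIndices hg) Candidate.computable_center
    Candidate.computable_scale).pairName (tupleName (pointName site (.of_computable .snd)))

theorem exists_isDugundji_dugundjiName {X : Type*} [MetricSpace X] {ν : ℕ → X}
    {g : ℕ × ℕ × ℕ → ℕ} {s : Baire} {A : Closeds X} (hν : DenseRange ν)
    (hg : ApproximatesDist ν g) (hA : (A : Set X).Nonempty)
    (hs : meetRep (rangeRep ν) (distRep ν) (fun n => s (n + 1)) A) :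
    ∃ V y, IsDugundji ν (1 / ((slack s : ℝ) + 1)) A V y ∧
      lfRep₂ ν (fstName (dugundjiName g s)) V ∧
      powRep (cauchyRep ν) (sndName (dugundjiName g s)) y := by
  obtain ⟨hrange, hdist⟩ := hs
  obtain ⟨z, hzA, hz, hdense⟩ := hrange.exists_dense_seq hA
  have whitney := isWhitneyFamily_admissibleIndices hν hg hA hdist hzA hz hdense
  refine ⟨_, _, whitney.isDugundji (by positivity) whitney.isLF_trimmedBall, ?_, fun i => ?_⟩
  · simpa only [dugundjiName, fstName_pairName] using whitney.lfRep₂_coverName hν hg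
  · rw [dugundjiName, sndName_pairName, compName_tupleName]
    exact hz (candidate i).site

end TTE

end

theorem mainTheorem5 {X : Type*} [MetricSpace X] (ν : ℕ → X)
    (hν : TTE.IsComputableMetricSpace ν) :
    TTE.OpComputable
      (TTE.numProdRep TTE.nuQ (TTE.meetRep (TTE.rangeRep ν) (TTE.distRep ν)))
      (TTE.dugundjiRep ν) TTE.domQ (TTE.opQ ν) := by
  obtain ⟨g, hg, approximates⟩ := hν.exists_approximatesDist
  obtain ⟨F, hF, mem_F⟩ :=
    (TTE.ComputableFunctional.dugundjiName hg).exists_isComputableFun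
  refine ⟨F, hF, fun s ⟨ε, A⟩ ⟨hε, hA, _⟩ ⟨hsε, hsA⟩ => ⟨_, mem_F s, ?_⟩⟩
  obtain rfl : TTE.nuQ (s 0) = ε := hsε
  obtain ⟨V, y, dugundji, cover_name, points_name⟩ :=
    TTE.exists_isDugundji_dugundjiName hν.dense approximates (nonempty_iff_ne_empty.2 hA) hsA
  exact ⟨⟨(V, y), A, dugundji.mono (TTE.one_div_slack_le_one s)⟩,
    dugundji.mono (TTE.one_div_slack_le hε), cover_name, points_name⟩
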